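/- Let $m\ge 0$ be an integer, let $l_0,l_1,\dots,l_m$ be positive integers and let $\alpha_1,\dots,\alpha_m$ be distinct variables, $\overline\alpha=(\alpha_1,\dots,\alpha_m)$, $\overline l=(l_0,\dots,l_m)$. Put $L_0=l_0+l_1+\dots+l_m$ and $L=l_1+\dots+l_m$, and define $\sigma_i=\sigma_i(\overline l,\overline\alpha)\in\mathbb{Q}[\overline\alpha]$ by $$w^{l_0}\prod_{j=1}^m(\alpha_j-w)^{l_j}=\sum_{i=l_0}^{L_0}\sigma_i(\overline l,\overline\alpha)\,w^i .$$ (1) There exist polynomials $A_{\overline l,j}(t,\overline\alpha)\in\mathbb{Q}[t,\overline\alpha]$ ($j=0,\dots,m$) and remainders $R_{\overline l,j}(t,\overline\alpha)$ ($j=1,\dots,m$), formal power series in $t$ with coefficients in $\mathbb{Q}[\overline\alpha]$, such that, with $e^{\alpha_jt}=\sum_{n\ge0}\alpha_j^nt^n/n!$, $$A_{\overline l,0}(t,\overline\alpha)\,e^{\alpha_jt}-A_{\overline l,j}(t,\overline\alpha)=R_{\overline l,j}(t,\overline\alpha),\qquad j=1,\dots,m,$$ $$\deg_tA_{\overline l,j}\le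 L_0-l_j\quad(j=0,\dots,m),\qquad L_0+1\le\operatorname{ord}_{t=0}R_{\overline l,j}<\infty\quad(j=1,\dots,m),$$ and $$A_{\overline l,0}(t,\overline\alpha)=\sum_{h=0}^{L}(L_0-h)!\,\sigma_{L_0-h}(\overline l,\overline\alpha)\,t^h .$$ (2) Let $U$ be the $L\times(L+1)$ matrix over $\mathbb{Q}[\overline\alpha]$ whose columns are numbered $h=0,\dots,L$, whose rows are the pairs $(j,k)$ with $1\le j\le m$, $0\le k\le l_j-1$ in lexicographic order, and whose entry in row $(j,k)$ and column $h$ is $\alpha_j^{L_0-k-h}/(L_0-k-h)!$, read as $0$ if $L_0-k-h<0$. Let $U[h]$ be the $L\times L$ minor obtained by removing column $h$. For $h=0,\dots,L$ one has $$U[h]=(-1)^h\,(L_0-h)!\,\sigma_{L_0-h}(\overline l,\overline\alpha)\cdot(-1)^LF_{m+1}\cdot\prod_{i=1}^m\alpha_i^{l_0l_i}\prod_{1\le i<j\le m}(\alpha_i-\alpha_j)^{l_il_j},$$ where, with $l_{m+1}:=1$, $F_{m+1}$ is the non-zero rational number $$F_{m+1}=\prod_{j=1}^{m+1}\left(\prod_{k=1}^{l_j}\frac1{(L_0+1-l_1-\dots-l_{j-1}-k)!}\prod_{1\le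 h<k\le l_j}(h-k)\right).$$ In particular each $U[h]$ is a non-zero polynomial. (3) The rank of $U$ over $\mathbb{Q}[\overline\alpha]$ is $L$. -/

import Mathlib

noncomputable section

namespace HermitePade

/-- The coefficient ring `ℚ[α₁, …, α_m]`; the variable `α_{j+1}` is `MvPolynomial.X j`, `j : Fin m`. -/
abbrev Coeffs (m : ℕ) : Type := MvPolynomial (Fin m) ℚ

/-- `L₀ = l₀ + l₁ + ⋯ + l_m`. -/
def bigL0 {m : ℕ} (l : Fin (m + 1) → ℕ) : ℕ := ∑ i, l i

/-- `L = l₁ + ⋯ + l_m`. -/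
def bigL {m : ℕ} (l : Fin (m + 1) → ℕ) : ℕ := ∑ j : Fin m, l j.succ

/-- The coefficient `σ_i` of `w ^ i` in `w ^ l₀ * ∏_{j=1}^m (α_j - w) ^ l_j`. -/
def sigma {m : ℕ} (l : Fin (m + 1) → ℕ) (i : ℕ) : Coeffs m :=
  ((Polynomial.X : Polynomial (Coeffs m)) ^ l 0 *
    ∏ j : Fin m, (Polynomial.C (MvPolynomial.X j) - Polynomial.X) ^ l j.succ).coeff i

/-- The formal power series `e^{α_j t}` in `t` over `ℚ[α₁, …, α_m]`. -/
def expSeries {m : ℕ} (j : Fin m) : PowerSeries (Coeffs m) :=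
  PowerSeries.rescale (MvPolynomial.X j) (PowerSeries.exp (Coeffs m))

/-- The `L × (L + 1)` matrix `U`. Its rows are the pairs `(j, k)` with `0 ≤ k < l_j`, listed in
lexicographic order (block after block), and its columns are `h = 0, …, L`. The entry is
`α_j ^ (L₀ - k - h) / (L₀ - k - h)!`, read as `0` if `L₀ - k - h < 0`. -/
def matU {m : ℕ} (l : Fin (m + 1) → ℕ) :
    Matrix (Fin (bigL l)) (Fin (bigL l + 1)) (Coeffs m) :=
  Matrix.of fun r h =>
    let p : (j : Fin m) × Fin (l j.succ) := finSigmaFinEquiv.symm r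
    if (p.2 : ℕ) + (h : ℕ) ≤ bigL0 l then
      MvPolynomial.C (1 / ((bigL0 l - p.2 - h).factorial : ℚ)) *
        MvPolynomial.X p.1 ^ (bigL0 l - p.2 - h)
    else 0

/-- The minor `U[h]`: the determinant of `U` with column `h` removed. -/
def minorU {m : ℕ} (l : Fin (m + 1) → ℕ) (h : Fin (bigL l + 1)) : Coeffs m :=
  ((matU l).submatrix id h.succAbove).det

/-- The rational constant
`F_m(l₀, …, l_m) = ∏_{j=1}^m (∏_{k=1}^{l_j} 1 / (L₀ - (l₁ + ⋯ + l_{j-1}) - k)!) ∏_{1 ≤ h < k ≤ l_j} (h - k)`.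
The subtractions of natural numbers are exact, and in the last product `h` and `k` are both
shifted by one. -/
def constF {m : ℕ} (l : Fin (m + 1) → ℕ) : ℚ :=
  ∏ j : Fin m,
    (∏ k ∈ Finset.Icc 1 (l j.succ),
        1 / ((bigL0 l - (∑ i ∈ Finset.Iio j, l i.succ) - k).factorial : ℚ)) *
      ∏ k ∈ Finset.range (l j.succ), ∏ h ∈ Finset.range k, ((h : ℚ) - (k : ℚ))

end HermitePade

end

/-!
Put `P(w) = w ^ l₀ * ∏ j, (α_j - w) ^ l_j = ∑ σ_i w ^ i` and `v_h = (L₀ - h)! σ_{L₀ - h}`. The entry of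
`U` in row `(j, k)` and column `h` is the `k`-th derivative of `x ^ (L₀ - h) / (L₀ - h)!` at `α_j`,
that is, `k! / (L₀ - h)!` times a coefficient of the Taylor expansion of `x ^ (L₀ - h)` at `α_j`. Two
facts follow.

* Entry `(j, k)` of `U v` is the `k`-th derivative of `P` at `α_j`, which vanishes for `k < l_j`
  (`sum_entry_mul_sigma_eq_zero`). The same sums are the coefficients of `t ^ (L₀ - k)` in
  `A₀ e^{α_j t}` with `A₀ = ∑ v_h t ^ h`, so truncating this series after degree `L₀ - l_j` leaves a
  remainder of order greater than `L₀`. The remainder is not zero, because `A e^{a t}` is never a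
  polynomial when `A ≠ 0` and `a ≠ 0` (`eq_zero_of_mul_rescale_exp_eq_coe`).
* Since `U v = 0`, Cramer's rule makes the signed minors of `U` proportional to `v`
  (`det_deleteColumn_mul_of_mulVec_eq_zero`), and `v_0 = ± L₀!` is not zero, so only `U[0]` has to be
  computed. Up to scaling of rows and columns and reversal of the columns, `U[0]` is a confluent
  Vandermonde determinant in the monomials `x ^ (l₀ + i)`, `i < L`. Replacing `x ^ i` by the Newton
  basis attached to the nodes `α_j`, repeated `l_j` times, is a unimodular change of columns and makes
  the matrix triangular (`det_confluentVandermonde`).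

All factors of the minors are non-zero. For `σ_{L₀ - h}` this is seen at `α_1 = ⋯ = α_m = 1`, where it
becomes a signed binomial coefficient. One non-zero minor gives the rank.
-/

namespace HermitePade

open Polynomial Finset

/-! ### Positions in a list of blocks -/

theorem finSigmaFinEquiv_val {m : ℕ} {n : Fin m → ℕ} (p : (j : Fin m) × Fin (n j)) :
    (finSigmaFinEquiv p : ℕ) = ∑ i ∈ Iio p.1, n i + p.2 := by
  rw [finSigmaFinEquiv_apply]
  congr 1
  refine Finset.sum_bij (fun i _ => Fin.castLE p.1.2.le i) (fun i _ => ?_) (fun i _ j _ h => ?_)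
    (fun i hi => ?_) (fun i _ => rfl)
  · rw [mem_Iio, Fin.lt_def]; exact i.2
  · exact Fin.castLE_injective _ h
  · exact ⟨⟨i, Fin.lt_def.1 (mem_Iio.1 hi)⟩, mem_univ _, rfl⟩

/-- `finSigmaFinEquiv` lists the pairs in lexicographic order. -/
theorem lex_of_lt_finSigmaFinEquiv {m : ℕ} {n : Fin m → ℕ} {p q : (j : Fin m) × Fin (n j)}
    (h : finSigmaFinEquiv p < finSigmaFinEquiv q) :
    p.1 < q.1 ∨ p.1 = q.1 ∧ (p.2 : ℕ) < q.2 := by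
  rw [Fin.lt_def, finSigmaFinEquiv_val, finSigmaFinEquiv_val] at h
  rcases lt_trichotomy p.1 q.1 with hlt | heq | hgt
  · exact Or.inl hlt
  · have hs : ∑ i ∈ Iio p.1, n i = ∑ i ∈ Iio q.1, n i := by rw [heq]
    exact Or.inr ⟨heq, by omega⟩
  · exfalso
    have hsub : insert q.1 (Iio q.1) ⊆ Iio p.1 := by
      intro i hi
      rcases mem_insert.1 hi with rfl | hi
      · exact mem_Iio.2 hgt
      · exact mem_Iio.2 ((mem_Iio.1 hi).trans hgt)
    have hle := sum_le_sum_of_subset (f := n) hsub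
    rw [sum_insert (by simp)] at hle
    have := q.2.2
    omega

/-! ### Confluent Vandermonde determinants and Cramer's rule -/

section Confluent

variable {R : Type*} [CommRing R] {m : ℕ}

theorem coeff_taylor_X_sub_C_pow_mul (a : R) (n k : ℕ) (q : R[X]) :
    (taylor a ((X - C a) ^ n * q)).coeff k = if n ≤ k then (taylor a q).coeff (k - n) else 0 := by
  rw [taylor_mul, taylor_pow, map_sub, taylor_X, taylor_C, add_sub_cancel_right,
    coeff_X_pow_mul']

/-- The Newton basis for the nodes `a 0, …, a (m - 1)`, the node `a j` being repeated `l j` times: the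
member at `(j, k)` is the product of the linear factors of all nodes listed before position
`(j, k)`, namely all repetitions of `a i` for `i < j` and `k` repetitions of `a j`. -/
noncomputable def newtonBasis (a : Fin m → R) {l : Fin m → ℕ} (p : (j : Fin m) × Fin (l j)) : R[X] :=
  (X - C (a p.1)) ^ (p.2 : ℕ) * ∏ i ∈ Iio p.1, (X - C (a i)) ^ l i

theorem newtonBasis_monic (a : Fin m → R) {l : Fin m → ℕ} (p : (j : Fin m) × Fin (l j)) :
    (newtonBasis a p).Monic :=
  ((monic_X_sub_C _).pow _).mul (monic_prod_of_monic _ _ fun _ _ => (monic_X_sub_C _).pow _)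

theorem natDegree_newtonBasis [Nontrivial R] (a : Fin m → R) {l : Fin m → ℕ}
    (p : (j : Fin m) × Fin (l j)) :
    (newtonBasis a p).natDegree = (finSigmaFinEquiv p : ℕ) := by
  rw [newtonBasis, ((monic_X_sub_C _).pow _).natDegree_mul
      (monic_prod_of_monic _ _ fun _ _ => (monic_X_sub_C _).pow _),
    natDegree_prod_of_monic _ _ fun _ _ => (monic_X_sub_C _).pow _, finSigmaFinEquiv_val]
  simp_rw [(monic_X_sub_C _).natDegree_pow, natDegree_X_sub_C, mul_one]
  exact add_comm _ _

/-- The confluent Vandermonde determinant in the monomials `x ^ (l₀ + i)`. The row `(j, k)` holds the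
`k`-th Taylor coefficients at `a j`, which are the `k`-th derivatives divided by `k!`. -/
theorem det_confluentVandermonde [Nontrivial R] (a : Fin m → R) (l : Fin m → ℕ) (l₀ : ℕ) :
    (Matrix.of fun r i : Fin (∑ j, l j) =>
      (taylor (a (finSigmaFinEquiv.symm r).1) (X ^ (l₀ + (i : ℕ)))).coeff
        ((finSigmaFinEquiv.symm r).2 : ℕ)).det =
    ∏ p : (j : Fin m) × Fin (l j), (a p.1 ^ l₀ * ∏ i ∈ Iio p.1, (a p.1 - a i) ^ l i) := by
  set M := Matrix.of fun r i : Fin (∑ j, l j) =>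
      (taylor (a (finSigmaFinEquiv.symm r).1) (X ^ (l₀ + (i : ℕ)))).coeff
        ((finSigmaFinEquiv.symm r).2 : ℕ)
  let B : Fin (∑ j, l j) → R[X] := fun c => newtonBasis a (finSigmaFinEquiv.symm c)
  have hdeg : ∀ c, (B c).natDegree = (c : ℕ) := fun c => by
    simp only [B, natDegree_newtonBasis, Equiv.apply_symm_apply]
  have hC := Matrix.det_matrixOfPolynomials B hdeg fun c => newtonBasis_monic _ _
  set N := Matrix.of fun i j : Fin (∑ j, l j) => (B j).coeff (i : ℕ)
  have hMN : ∀ r c, (M * N) r c =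
      (taylor (a (finSigmaFinEquiv.symm r).1) (B c * X ^ l₀)).coeff
        ((finSigmaFinEquiv.symm r).2 : ℕ) := by
    intro r c
    have hB : B c * X ^ l₀ = ∑ i : Fin (∑ j, l j), C ((B c).coeff i) * X ^ (l₀ + (i : ℕ)) := by
      conv_lhs => rw [(B c).as_sum_range' (∑ j, l j) (by rw [hdeg]; exact c.2)]
      rw [Finset.sum_range, Finset.sum_mul]
      refine Finset.sum_congr rfl fun i _ => ?_
      rw [← C_mul_X_pow_eq_monomial, mul_assoc, ← pow_add, add_comm]
    rw [hB, map_sum, finsetSum_coeff, Matrix.mul_apply]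
    refine Finset.sum_congr rfl fun i _ => ?_
    rw [taylor_mul, taylor_C, coeff_C_mul, mul_comm]
    rfl
  -- The member of the Newton basis at `q` vanishes at `a p.1` to order greater than `p.2` if `p`
  -- precedes `q`.
  have hlow : (M * N).IsLowerTriangular := by
    intro r c hrc
    rw [hMN]
    have hrc' : r < c := hrc
    obtain ⟨p, rfl⟩ := finSigmaFinEquiv.surjective r
    obtain ⟨q, rfl⟩ := finSigmaFinEquiv.surjective c
    simp only [B]
    rw [Equiv.symm_apply_apply, Equiv.symm_apply_apply]
    rcases lex_of_lt_finSigmaFinEquiv hrc' with h | ⟨h, hk⟩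
    · rw [newtonBasis, ← mul_prod_erase _ _ (mem_Iio.2 h), mul_left_comm, mul_assoc,
        coeff_taylor_X_sub_C_pow_mul, if_neg (not_le.2 p.2.2)]
    · rw [newtonBasis, mul_assoc, ← congrArg a h, coeff_taylor_X_sub_C_pow_mul, if_neg (not_le.2 hk)]
  rw [← mul_one M.det, ← hC, ← Matrix.det_mul, Matrix.det_of_isLowerTriangular _ hlow,
    ← finSigmaFinEquiv.prod_comp]
  refine Finset.prod_congr rfl fun p _ => ?_
  rw [hMN]
  simp only [B]
  rw [Equiv.symm_apply_apply, newtonBasis, mul_assoc, coeff_taylor_X_sub_C_pow_mul,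
    if_pos le_rfl, Nat.sub_self, taylor_coeff_zero]
  simp [eval_prod, mul_comm]

/-- Reversal of the columns. The sign is left as a product so that it can be distributed over the
diagonal entries of a triangular matrix. -/
theorem det_submatrix_rev {n : ℕ} (M : Matrix (Fin n) (Fin n) R) :
    (M.submatrix id Fin.rev).det = (∏ i : Fin n, (-1) ^ (i : ℕ)) * M.det := by
  have h := Matrix.det_permute' Fin.revPerm M
  rw [Equiv.Perm.sign_eq_prod_prod_Iio] at h
  have h2 : ∀ j : Fin n, (∏ i ∈ Iio j, if Fin.revPerm i < Fin.revPerm j then (1 : ℤˣ) else -1) =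
      (-1) ^ (j : ℕ) := by
    intro j
    rw [prod_congr rfl fun i hi => if_neg (by simpa using (mem_Iio.1 hi).le), prod_const,
      Fin.card_Iio]
  simp_rw [h2] at h
  push_cast at h
  exact h

/-- The signed maximal minors of an `n × (n + 1)` matrix are proportional to any vector in its
kernel. -/
theorem det_deleteColumn_mul_of_mulVec_eq_zero {n : ℕ} (M : Matrix (Fin n) (Fin (n + 1)) R)
    (v : Fin (n + 1) → R) (hv : M.mulVec v = 0) (h : Fin (n + 1)) :
    v 0 * (M.submatrix id h.succAbove).det =
      (-1) ^ (h : ℕ) * v h * (M.submatrix id (Fin.succAbove 0)).det := by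
  -- With the first unit vector put on top of `M`, the first column of the adjugate holds the signed
  -- minors of `M`, and `B v` is supported on the first coordinate.
  let B : Matrix (Fin (n + 1)) (Fin (n + 1)) R := Matrix.of (Fin.cons (Pi.single 0 1) fun r => M r)
  have hsub : ∀ i, B.adjugate i 0 = (-1) ^ (i : ℕ) * (M.submatrix id i.succAbove).det := by
    intro i
    rw [Matrix.adjugate_fin_succ_eq_det_submatrix]
    simp only [Fin.val_zero, zero_add]
    rfl
  have hB : B.mulVec v = Pi.single 0 (v 0) := by
    ext r
    refine Fin.cases ?_ (fun r => ?_) r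
    · simp [B, Matrix.mulVec]
    · have := congrFun hv r
      simpa [B, Matrix.mulVec] using this
  have hdet : B.det = (M.submatrix id (Fin.succAbove 0)).det := by
    have h1 := congrFun (congrFun (Matrix.mul_adjugate B) 0) 0
    rw [Matrix.mul_apply, Fin.sum_univ_succ] at h1
    simpa [B, hsub] using h1.symm
  have h2 : B.adjugate.mulVec (B.mulVec v) = B.det • v := by
    rw [Matrix.mulVec_mulVec, Matrix.adjugate_mul, Matrix.smul_mulVec, Matrix.one_mulVec]
  have h3 := congrFun h2 h
  rw [hB, Matrix.mulVec_single, hdet] at h3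
  simp only [Pi.smul_apply, Matrix.col_apply, hsub, MulOpposite.smul_eq_mul_unop,
    MulOpposite.unop_op, smul_eq_mul] at h3
  have hs : ((-1 : R) ^ (h : ℕ)) * (-1) ^ (h : ℕ) = 1 := by
    rw [← mul_pow]; simp
  linear_combination (-1) ^ (h : ℕ) * h3 - (v 0 * (M.submatrix id h.succAbove).det) * hs

end Confluent

/-! ### Polynomial multiples of an exponential series -/

section Exponential

variable {R : Type*} [CommRing R] [Algebra ℚ R]

theorem derivative_rescale_exp (a : R) :
    PowerSeries.derivative R (PowerSeries.rescale a (PowerSeries.exp R)) =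
      PowerSeries.C a * PowerSeries.rescale a (PowerSeries.exp R) := by
  ext n
  have h := congrArg (PowerSeries.coeff n) (PowerSeries.derivative_exp R)
  rw [PowerSeries.coeff_derivative] at h
  rw [PowerSeries.coeff_derivative, PowerSeries.coeff_rescale, PowerSeries.coeff_C_mul,
    PowerSeries.coeff_rescale, ← h]
  ring

/-- A non-zero polynomial times `e^{a t}` with `a ≠ 0` is not a polynomial. Differentiating
`A e^{a t} = B` replaces `A` by `A' + a A`, of the same degree as `A`, and lowers the degree of `B`. -/
theorem eq_zero_of_mul_rescale_exp_eq_coe [IsDomain R] {a : R} (ha : a ≠ 0) {A B : R[X]}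
    (h : (A : PowerSeries R) * PowerSeries.rescale a (PowerSeries.exp R) = B) : A = 0 := by
  obtain ⟨n, hn⟩ : ∃ n : ℕ, B.degree < n := ⟨B.natDegree + 1, by
    exact_mod_cast degree_le_natDegree.trans_lt (by exact_mod_cast Nat.lt_succ_self _)⟩
  induction n generalizing A B with
  | zero =>
    have hB : B = 0 := by
      rw [← degree_eq_bot]
      exact Nat.WithBot.lt_zero_iff.1 (by exact_mod_cast hn)
    rw [hB, Polynomial.coe_zero, mul_eq_zero] at h
    rcases h with h | h
    · exact Polynomial.coe_eq_zero_iff.1 h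
    · have := congrArg (PowerSeries.coeff 0) h
      simp [PowerSeries.coeff_rescale] at this
  | succ n ih =>
    have h' := congrArg (PowerSeries.derivative R) h
    rw [Derivation.leibniz, derivative_rescale_exp, PowerSeries.derivative_coe,
      PowerSeries.derivative_coe, smul_eq_mul, smul_eq_mul] at h'
    have hA : derivative A + C a * A = 0 := by
      refine ih (B := derivative B) ?_ ?_
      · rw [← h', Polynomial.coe_add, Polynomial.coe_mul, Polynomial.coe_C]
        ring
      · by_cases hB : B = 0
        · simp [hB]
        · have := degree_derivative_lt hB
          rw [degree_eq_natDegree hB] at hn this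
          refine this.trans_le ?_
          have : B.natDegree < n + 1 := by exact_mod_cast hn
          exact_mod_cast Nat.lt_succ_iff.1 this
    by_contra hne
    have h1 := degree_derivative_lt hne
    rw [eq_neg_of_add_eq_zero_left hA, degree_neg, degree_C_mul ha] at h1
    exact lt_irrefl _ h1

end Exponential

/-! ### The coefficients `σ_i` -/

variable {m : ℕ}

theorem bigL0_eq (l : Fin (m + 1) → ℕ) : bigL0 l = l 0 + bigL l :=
  Fin.sum_univ_succ l

/-- The polynomial `w ^ l₀ * ∏ j, (α_j - w) ^ l_j`, whose coefficients are the `σ_i`. -/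
noncomputable def sigmaPoly (l : Fin (m + 1) → ℕ) : (Coeffs m)[X] :=
  X ^ l 0 * ∏ j : Fin m, (C (MvPolynomial.X j) - X) ^ l j.succ

theorem natDegree_prod_C_sub_X_le (l : Fin (m + 1) → ℕ) :
    (∏ j : Fin m, (C (MvPolynomial.X j : Coeffs m) - X) ^ l j.succ).natDegree ≤ bigL l := by
  refine (natDegree_prod_le _ _).trans (sum_le_sum fun j _ => ?_)
  refine natDegree_pow_le.trans ?_
  have : (C (MvPolynomial.X j : Coeffs m) - X).natDegree ≤ 1 := by compute_degree
  simpa using Nat.mul_le_mul_left (l j.succ) this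

theorem sigma_bigL0_sub (l : Fin (m + 1) → ℕ) {h : ℕ} (hh : h ≤ bigL l) :
    sigma l (bigL0 l - h) =
      (∏ j : Fin m, (C (MvPolynomial.X j : Coeffs m) - X) ^ l j.succ).coeff (bigL l - h) := by
  rw [sigma, bigL0_eq, coeff_X_pow_mul', if_pos (by omega)]
  congr 1
  omega

theorem sigmaPoly_eq_sum (l : Fin (m + 1) → ℕ) :
    sigmaPoly l = ∑ h ∈ range (bigL l + 1), C (sigma l (bigL0 l - h)) * X ^ (bigL0 l - h) := by
  rw [sigmaPoly, as_sum_range' _ _ (Nat.lt_succ_of_le (natDegree_prod_C_sub_X_le l)),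
    ← sum_range_reflect, mul_sum]
  refine sum_congr rfl fun h hh => ?_
  have hh' : h ≤ bigL l := Nat.lt_succ_iff.1 (mem_range.1 hh)
  rw [sigma_bigL0_sub l hh', ← C_mul_X_pow_eq_monomial, mul_left_comm, ← pow_add, bigL0_eq]
  congr 3
  · omega

theorem sigma_bigL0 (l : Fin (m + 1) → ℕ) : sigma l (bigL0 l) = (-1) ^ bigL l := by
  have h := sigma_bigL0_sub l (Nat.zero_le _)
  rw [Nat.sub_zero, Nat.sub_zero] at h
  rw [h]
  have h2 : (∏ j : Fin m, (C (MvPolynomial.X j : Coeffs m) - X) ^ l j.succ) =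
      C ((-1) ^ bigL l) * ∏ j : Fin m, (X - C (MvPolynomial.X j : Coeffs m)) ^ l j.succ := by
    rw [bigL, ← prod_pow_eq_pow_sum, map_prod, ← prod_mul_distrib]
    refine prod_congr rfl fun j _ => ?_
    rw [map_pow, ← mul_pow, map_neg, map_one]
    congr 1
    ring
  have hm : ∀ j ∈ (univ : Finset (Fin m)),
      ((X - C (MvPolynomial.X j : Coeffs m)) ^ l j.succ).Monic :=
    fun j _ => (monic_X_sub_C _).pow _
  have hd : (∏ j : Fin m, (X - C (MvPolynomial.X j : Coeffs m)) ^ l j.succ).natDegree = bigL l := by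
    rw [natDegree_prod_of_monic _ _ hm]
    simp [bigL, (monic_X_sub_C _).natDegree_pow]
  rw [h2, coeff_C_mul, ← hd, (monic_prod_of_monic _ _ hm).coeff_natDegree, mul_one]

/-- At `α_1 = ⋯ = α_m = 1` the product `∏ j, (α_j - w) ^ l_j` becomes `(1 - w) ^ L`, which has no
vanishing coefficient in degrees at most `L`. -/
theorem sigma_ne_zero (l : Fin (m + 1) → ℕ) {h : ℕ} (hh : h ≤ bigL l) :
    sigma l (bigL0 l - h) ≠ 0 := by
  intro h0
  rw [sigma_bigL0_sub l hh] at h0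
  have h1 := congrArg (MvPolynomial.aeval fun _ : Fin m => (1 : ℚ)) h0
  rw [map_zero, ← AlgHom.coe_toRingHom, ← coeff_map, Polynomial.map_prod] at h1
  simp only [Polynomial.map_pow, Polynomial.map_sub, map_C, map_X, AlgHom.coe_toRingHom,
    MvPolynomial.aeval_X] at h1
  have h2 : (C (1 : ℚ) - X) = C (-1) * (X + C (-1)) := by
    simp only [map_neg, map_one]; ring
  rw [prod_pow_eq_pow_sum, h2, mul_pow, ← C_pow, coeff_C_mul, coeff_X_add_C_pow] at h1
  have h3 : ((bigL l).choose (bigL l - h) : ℚ) ≠ 0 := by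
    exact_mod_cast (Nat.choose_pos (Nat.sub_le _ _)).ne'
  exact mul_ne_zero (pow_ne_zero _ (by norm_num))
    (mul_ne_zero (pow_ne_zero _ (by norm_num)) h3) h1

theorem coeff_taylor_sigmaPoly_eq_zero (l : Fin (m + 1) → ℕ) (j : Fin m) {k : ℕ}
    (hk : k < l j.succ) : (taylor (MvPolynomial.X j) (sigmaPoly l)).coeff k = 0 := by
  have h : (C (MvPolynomial.X j : Coeffs m) - X) ^ l j.succ =
      (X - C (MvPolynomial.X j)) ^ l j.succ * C ((-1) ^ l j.succ) := by
    rw [C_pow, ← mul_pow, map_neg, map_one]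
    congr 1
    ring
  rw [sigmaPoly, ← mul_prod_erase _ _ (mem_univ j), mul_left_comm, h, mul_assoc,
    coeff_taylor_X_sub_C_pow_mul, if_neg (not_le.2 hk)]

/-! ### The kernel of `U` and the approximants -/

/-- The entries of `U` are scaled Taylor coefficients of monomials. The case distinction is absorbed
on the right by `Nat.choose (N - h) k = 0` for `N - h < k`. -/
theorem entry_eq_coeff_taylor (x : Coeffs m) {N h : ℕ} (hh : h ≤ N) (k : ℕ) :
    (if k + h ≤ N then MvPolynomial.C (1 / ((N - k - h).factorial : ℚ)) * x ^ (N - k - h) else 0) =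
      (k.factorial : Coeffs m) * (MvPolynomial.C (1 / ((N - h).factorial : ℚ)) *
        (taylor x (X ^ (N - h))).coeff k) := by
  rw [taylor_X_pow, coeff_X_add_C_pow]
  split_ifs with hk
  · have hq : (1 : ℚ) / ((N - k - h).factorial : ℚ) =
        k.factorial * (1 / ((N - h).factorial : ℚ)) * (N - h).choose k := by
      have := Nat.choose_mul_factorial_mul_factorial (n := N - h) (k := k) (by omega)
      rw [show N - h - k = N - k - h by omega] at this
      have h1 : ((N - k - h).factorial : ℚ) ≠ 0 := by exact_mod_cast Nat.factorial_ne_zero _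
      have h2 : ((N - h).factorial : ℚ) ≠ 0 := by exact_mod_cast Nat.factorial_ne_zero _
      field_simp
      rw [← this]
      push_cast
      ring
    rw [hq, show N - h - k = N - k - h by omega]
    simp only [map_mul, map_natCast]
    ring
  · rw [Nat.choose_eq_zero_of_lt (by omega)]
    simp

/-- Up to the factor `k!`, the sum is the `k`-th Taylor coefficient of `sigmaPoly l` at `α_j`, a root
of multiplicity at least `l_j`. -/
theorem sum_entry_mul_sigma_eq_zero (l : Fin (m + 1) → ℕ) (j : Fin m) {k : ℕ}
    (hk : k < l j.succ) :
    ∑ h ∈ range (bigL l + 1),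
      (if k + h ≤ bigL0 l then
        MvPolynomial.C (1 / ((bigL0 l - k - h).factorial : ℚ)) *
          (MvPolynomial.X j : Coeffs m) ^ (bigL0 l - k - h)
        else 0) * (((bigL0 l - h).factorial : Coeffs m) * sigma l (bigL0 l - h)) = 0 := by
  have h0 := coeff_taylor_sigmaPoly_eq_zero l j hk
  rw [sigmaPoly_eq_sum, map_sum, finsetSum_coeff] at h0
  calc _ = (k.factorial : Coeffs m) * ∑ h ∈ range (bigL l + 1),
        (taylor (MvPolynomial.X j) (C (sigma l (bigL0 l - h)) * X ^ (bigL0 l - h))).coeff k := by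
        rw [mul_sum]
        refine sum_congr rfl fun h hh => ?_
        have hh' : h ≤ bigL0 l := by
          have := mem_range.1 hh
          rw [bigL0_eq]
          omega
        have hc : MvPolynomial.C (1 / ((bigL0 l - h).factorial : ℚ)) *
            ((bigL0 l - h).factorial : Coeffs m) = 1 := by
          rw [← map_natCast (MvPolynomial.C : ℚ →+* Coeffs m), ← map_mul, one_div,
            inv_mul_cancel₀ (by exact_mod_cast Nat.factorial_ne_zero _), map_one]
        rw [entry_eq_coeff_taylor _ hh', taylor_mul, taylor_C, coeff_C_mul]
        linear_combination (k.factorial : Coeffs m) * sigma l (bigL0 l - h) *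
          (taylor (MvPolynomial.X j : Coeffs m) (X ^ (bigL0 l - h))).coeff k * hc
    _ = 0 := by rw [h0, mul_zero]

theorem coeff_expSeries (j : Fin m) (n : ℕ) : PowerSeries.coeff n (expSeries j) =
    MvPolynomial.C (1 / (n.factorial : ℚ)) * (MvPolynomial.X j : Coeffs m) ^ n := by
  rw [expSeries, PowerSeries.coeff_rescale, PowerSeries.coeff_exp, MvPolynomial.algebraMap_eq,
    mul_comm]

theorem coeff_sum_mul_powerSeries {R : Type*} [CommRing R] (v : ℕ → R) (s : Finset ℕ)
    (f : PowerSeries R) (n : ℕ) :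
    PowerSeries.coeff n (((∑ h ∈ s, C (v h) * X ^ h : R[X]) : PowerSeries R) * f) =
      ∑ h ∈ s, (if h ≤ n then PowerSeries.coeff (n - h) f else 0) * v h := by
  have hcoe : ((∑ h ∈ s, C (v h) * X ^ h : R[X]) : PowerSeries R) =
      ∑ h ∈ s, PowerSeries.C (v h) * PowerSeries.X ^ h := by
    rw [← coeToPowerSeries.ringHom_apply, map_sum]
    simp
  rw [hcoe, sum_mul, map_sum]
  refine sum_congr rfl fun h _ => ?_
  rw [mul_assoc, PowerSeries.coeff_C_mul, PowerSeries.coeff_X_pow_mul', mul_comm]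

theorem exists_approximants (l : Fin (m + 1) → ℕ) :
    ∃ (A : Fin (m + 1) → Polynomial (Coeffs m)) (R : Fin m → PowerSeries (Coeffs m)),
      (∀ j : Fin m,
        (A 0 : PowerSeries (Coeffs m)) * expSeries j - (A j.succ : PowerSeries (Coeffs m)) = R j) ∧
      (∀ j : Fin (m + 1), (A j).natDegree ≤ bigL0 l - l j) ∧
      (∀ j : Fin m, ((bigL0 l + 1 : ℕ) : ℕ∞) ≤ (R j).order ∧ (R j).order < ⊤) ∧
      A 0 = ∑ h ∈ range (bigL l + 1),
        C (((bigL0 l - h).factorial : Coeffs m) * sigma l (bigL0 l - h)) * X ^ h := by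
  set A₀ : (Coeffs m)[X] := ∑ h ∈ range (bigL l + 1),
    C (((bigL0 l - h).factorial : Coeffs m) * sigma l (bigL0 l - h)) * X ^ h with hA₀
  have hcoeff : ∀ h, A₀.coeff h = if h < bigL l + 1 then
      ((bigL0 l - h).factorial : Coeffs m) * sigma l (bigL0 l - h) else 0 := fun h => by
    rw [hA₀, finsetSum_coeff]
    simp_rw [coeff_C_mul_X_pow]
    simp
  have hne : A₀ ≠ 0 := by
    intro h0
    have h1 := hcoeff 0
    rw [h0, coeff_zero, if_pos (Nat.succ_pos _)] at h1
    exact mul_ne_zero (by exact_mod_cast Nat.factorial_ne_zero _)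
      (sigma_ne_zero l (Nat.zero_le _)) h1.symm
  let A : Fin (m + 1) → (Coeffs m)[X] := Fin.cons A₀ fun j =>
    PowerSeries.trunc (bigL0 l - l j.succ + 1) ((A₀ : PowerSeries (Coeffs m)) * expSeries j)
  refine ⟨A, fun j => (A 0 : PowerSeries (Coeffs m)) * expSeries j -
    (A j.succ : PowerSeries (Coeffs m)),
    fun _ => rfl, fun j => ?_, fun j => ⟨?_, ?_⟩, rfl⟩
  · refine Fin.cases ?_ (fun j => ?_) j
    · change A₀.natDegree ≤ _
      refine natDegree_le_iff_coeff_eq_zero.2 fun n hn => ?_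
      rw [hcoeff, if_neg]
      rw [bigL0_eq] at hn
      omega
    · exact Nat.lt_succ_iff.1 (PowerSeries.natDegree_trunc_lt _ _)
  · refine PowerSeries.nat_le_order _ _ fun n hn => ?_
    change PowerSeries.coeff n ((A₀ : PowerSeries (Coeffs m)) * expSeries j -
      ((PowerSeries.trunc (bigL0 l - l j.succ + 1)
        ((A₀ : PowerSeries (Coeffs m)) * expSeries j) : (Coeffs m)[X]) :
          PowerSeries (Coeffs m))) = 0
    rw [map_sub, coeff_coe, PowerSeries.coeff_trunc]
    split_ifs with hlt
    · exact sub_self _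
    -- The coefficients of `t ^ (L₀ - k)`, `k < l_j`, are the entries of `U v` in block `j`.
    · obtain ⟨k, hk, rfl⟩ : ∃ k, k < l j.succ ∧ n = bigL0 l - k :=
        ⟨bigL0 l - n, by omega, by omega⟩
      have hkL : k ≤ bigL0 l := by omega
      rw [sub_zero, hA₀, coeff_sum_mul_powerSeries]
      refine (sum_congr rfl fun h _ => ?_).trans (sum_entry_mul_sigma_eq_zero l j hk)
      rw [coeff_expSeries]
      congr 1
      exact if_congr (by omega) rfl rfl
  · rw [lt_top_iff_ne_top, Ne, PowerSeries.order_eq_top, sub_eq_zero]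
    exact fun h => hne (eq_zero_of_mul_rescale_exp_eq_coe (MvPolynomial.X_ne_zero j) h)

/-! ### The constant `F` -/

theorem prod_range_sub_self (k : ℕ) :
    ∏ h ∈ range k, ((h : ℚ) - k) = (-1) ^ k * k.factorial := by
  rw [← prod_range_reflect, ← prod_range_add_one_eq_factorial, Nat.cast_prod, ← card_range k,
    ← prod_const, card_range, ← prod_mul_distrib]
  refine prod_congr rfl fun h hh => ?_
  have := mem_range.1 hh
  rw [Nat.sub_sub, Nat.cast_sub (by omega)]
  push_cast
  ring

/-- With `l_{m+1} = 1` the factorials in `F_{m+1}` are those of `L₀, L₀ - 1, …, l₀`, that is, of the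
exponents of all columns of `U`. Multiplication by `L₀!` leaves those of the columns that occur in
`U[0]`. -/
theorem constF_snoc_one_mul_factorial (l : Fin (m + 1) → ℕ) :
    constF (Fin.snoc l 1 : Fin (m + 1 + 1) → ℕ) * (bigL0 l).factorial =
      (∏ i : Fin (bigL l), 1 / ((bigL0 l - 1 - (i : ℕ)).factorial : ℚ)) *
        ∏ p : (j : Fin m) × Fin (l j.succ), (-1) ^ (p.2 : ℕ) * ((p.2 : ℕ).factorial : ℚ) := by
  have hsucc : ∀ j : Fin m, (Fin.snoc l 1 : Fin (m + 1 + 1) → ℕ) j.castSucc.succ = l j.succ :=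
    fun j => by rw [Fin.succ_castSucc, Fin.snoc_castSucc]
  have hlast : (Fin.snoc l 1 : Fin (m + 1 + 1) → ℕ) (Fin.last m).succ = 1 := by
    rw [Fin.succ_last, Fin.snoc_last]
  have hN : bigL0 (Fin.snoc l 1 : Fin (m + 1 + 1) → ℕ) = bigL0 l + 1 := by
    rw [bigL0, Fin.sum_univ_castSucc]
    simp [bigL0]
  have hfac : ∏ j : Fin m, ∏ k ∈ Icc 1 (l j.succ),
      1 / ((bigL0 l + 1 - (∑ i ∈ Iio j, l i.succ) - k).factorial : ℚ) =
      ∏ i ∈ range (bigL l), 1 / ((bigL0 l - i).factorial : ℚ) := by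
    rw [prod_range, bigL, ← finSigmaFinEquiv.prod_comp, Fintype.prod_sigma]
    refine prod_congr rfl fun j _ => ?_
    rw [← Ico_succ_right_eq_Icc, prod_Ico_eq_prod_range, prod_range]
    refine prod_congr rfl fun k _ => ?_
    rw [finSigmaFinEquiv_val]
    congr 3
    dsimp only
    omega
  have hsplit : (∏ i ∈ range (bigL l), 1 / ((bigL0 l - i).factorial : ℚ)) *
      (1 / ((bigL0 l - bigL l).factorial : ℚ)) * (bigL0 l).factorial =
      ∏ i ∈ range (bigL l), 1 / ((bigL0 l - 1 - i).factorial : ℚ) := by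
    rw [← prod_range_succ (fun i => 1 / ((bigL0 l - i).factorial : ℚ)), prod_range_succ', mul_assoc,
      Nat.sub_zero, one_div_mul_cancel (by exact_mod_cast Nat.factorial_ne_zero _), mul_one]
    refine prod_congr rfl fun i _ => ?_
    rw [Nat.sub_sub, add_comm]
  rw [constF, Fin.prod_univ_castSucc, hN]
  simp_rw [hsucc, hlast, Fin.Iio_castSucc, Fin.Iio_last_eq_map, sum_map]
  simp only [Fin.coe_castSuccEmb, hsucc]
  rw [prod_mul_distrib, hfac, Fintype.prod_sigma, ← prod_range (fun i =>
    1 / ((bigL0 l - 1 - i).factorial : ℚ)), ← hsplit]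
  simp_rw [prod_range_sub_self]
  simp only [Icc_self, prod_singleton, range_one, pow_zero, Nat.factorial_zero, Nat.cast_one,
    mul_one]
  have h1 : bigL0 l + 1 - ∑ i : Fin m, l i.succ - 1 = bigL0 l - bigL l := by
    rw [bigL]; omega
  rw [h1]
  simp_rw [prod_range]
  ring

theorem constF_ne_zero {n : ℕ} (l : Fin (n + 1) → ℕ) : constF l ≠ 0 := by
  refine prod_ne_zero_iff.2 fun j _ => mul_ne_zero (prod_ne_zero_iff.2 fun k _ => ?_)
    (prod_ne_zero_iff.2 fun k _ => ?_)
  · exact one_div_ne_zero (by exact_mod_cast Nat.factorial_ne_zero _)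
  · rw [prod_range_sub_self]
    exact mul_ne_zero (pow_ne_zero _ (by norm_num)) (by exact_mod_cast Nat.factorial_ne_zero _)

/-! ### The minors and the rank of `U` -/

theorem matU_mulVec_eq_zero (l : Fin (m + 1) → ℕ) :
    (matU l).mulVec (fun h => ((bigL0 l - h).factorial : Coeffs m) * sigma l (bigL0 l - h)) = 0 := by
  ext1 r
  have h := sum_entry_mul_sigma_eq_zero l (finSigmaFinEquiv.symm r).1 (finSigmaFinEquiv.symm r).2.2
  rw [sum_range] at h
  exact h

theorem minorU_zero (l : Fin (m + 1) → ℕ) :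
    minorU l 0 = ((bigL0 l).factorial : Coeffs m) *
      MvPolynomial.C (constF (Fin.snoc l 1 : Fin (m + 1 + 1) → ℕ)) *
      (∏ i : Fin m, MvPolynomial.X i ^ (l 0 * l i.succ)) *
      ∏ i : Fin m, ∏ j ∈ Ioi i,
        (MvPolynomial.X i - MvPolynomial.X j) ^ (l i.succ * l j.succ) := by
  let σ : ((j : Fin m) × Fin (l j.succ)) ≃ Fin (bigL l) := finSigmaFinEquiv
  let M : Matrix (Fin (bigL l)) (Fin (bigL l)) (Coeffs m) := Matrix.of fun r i =>
    (taylor (MvPolynomial.X (σ.symm r).1 : Coeffs m) (X ^ (l 0 + (i : ℕ)))).coeff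
      ((σ.symm r).2 : ℕ)
  have hM : M.det = ∏ p : (j : Fin m) × Fin (l j.succ), ((MvPolynomial.X p.1 : Coeffs m) ^ l 0 *
      ∏ i ∈ Iio p.1, (MvPolynomial.X p.1 - MvPolynomial.X i) ^ l i.succ) :=
    det_confluentVandermonde (fun j => (MvPolynomial.X j : Coeffs m)) (fun j => l j.succ) (l 0)
  have hU : (matU l).submatrix id (Fin.succAbove 0) = Matrix.of fun r i =>
      (((σ.symm r).2 : ℕ).factorial : Coeffs m) * (Matrix.of fun r' (i' : Fin (bigL l)) =>
        (MvPolynomial.C (1 / ((bigL0 l - 1 - (i' : ℕ)).factorial : ℚ)) : Coeffs m) *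
          (M.submatrix id Fin.rev) r' i') r i := by
    ext1 r i
    have hi := i.2
    have h0 := bigL0_eq l
    have h := entry_eq_coeff_taylor (MvPolynomial.X (σ.symm r).1 : Coeffs m)
      (N := bigL0 l) (h := i + 1) (by omega) ((σ.symm r).2 : ℕ)
    refine Eq.trans ?_ (h.trans ?_)
    · rfl
    · simp only [Matrix.of_apply, Matrix.submatrix_apply, id, M, Fin.val_rev]
      rw [Nat.sub_sub, add_comm 1]
      congr 5
      omega
  rw [minorU, hU, Matrix.det_mul_column, Matrix.det_mul_row, det_submatrix_rev, hM]
  have hF := congrArg (MvPolynomial.C : ℚ →+* Coeffs m) (constF_snoc_one_mul_factorial l)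
  simp only [map_mul, map_prod, map_natCast, map_pow, map_neg, map_one] at hF
  rw [mul_comm ((bigL0 l).factorial : Coeffs m), hF, ← σ.prod_comp (fun i => (-1) ^ (i : ℕ)),
    σ.symm.prod_comp (fun p => ((p.2 : ℕ).factorial : Coeffs m))]
  have hpow : ∏ i : Fin m, (MvPolynomial.X i : Coeffs m) ^ (l 0 * l i.succ) =
      ∏ p : (j : Fin m) × Fin (l j.succ), MvPolynomial.X p.1 ^ l 0 := by
    rw [Fintype.prod_sigma]
    simp [pow_mul]
  have hdiff : ∏ i : Fin m, ∏ j ∈ Ioi i,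
        (MvPolynomial.X i - MvPolynomial.X j : Coeffs m) ^ (l i.succ * l j.succ) =
      ∏ p : (j : Fin m) × Fin (l j.succ), ∏ i ∈ Iio p.1,
        (MvPolynomial.X i - MvPolynomial.X p.1) ^ l i.succ := by
    rw [Fintype.prod_sigma, prod_comm' (t' := univ) (s' := fun j => Iio j) (by simp)]
    simp [pow_mul, prod_pow]
  -- The position of `p` is `p.2 + ∑ i < p.1, l i.succ`, so its sign changes the orientation of each
  -- difference and turns `p.2!` into the product of the `h - p.2` over `h < p.2`.
  have hsign : ∀ p : (j : Fin m) × Fin (l j.succ),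
      (-1 : Coeffs m) ^ (σ p : ℕ) * ∏ i ∈ Iio p.1,
        (MvPolynomial.X p.1 - MvPolynomial.X i : Coeffs m) ^ l i.succ =
      (-1) ^ (p.2 : ℕ) * ∏ i ∈ Iio p.1,
        (MvPolynomial.X i - MvPolynomial.X p.1 : Coeffs m) ^ l i.succ := by
    intro p
    rw [show (σ p : ℕ) = _ from finSigmaFinEquiv_val p, pow_add, ← prod_pow_eq_pow_sum,
      mul_right_comm, ← prod_mul_distrib, mul_comm]
    congr 1
    refine prod_congr rfl fun i _ => ?_
    rw [← mul_pow]
    congr 1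
    ring
  rw [hpow, hdiff]
  have hkey := prod_congr rfl fun p (_ : p ∈ univ) => hsign p
  simp only [prod_mul_distrib] at hkey ⊢
  linear_combination (∏ p : (j : Fin m) × Fin (l j.succ), ((p.2 : ℕ).factorial : Coeffs m)) *
    (∏ i : Fin (bigL l), MvPolynomial.C (1 / ((bigL0 l - 1 - (i : ℕ)).factorial : ℚ))) *
    (∏ p : (j : Fin m) × Fin (l j.succ), MvPolynomial.X p.1 ^ l 0) * hkey

theorem minorU_eq (l : Fin (m + 1) → ℕ) (h : Fin (bigL l + 1)) :
    minorU l h =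
      (-1) ^ (h : ℕ) * ((bigL0 l - h).factorial : Coeffs m) * sigma l (bigL0 l - h) *
        ((-1) ^ bigL l * MvPolynomial.C (constF (Fin.snoc l 1 : Fin (m + 1 + 1) → ℕ))) *
        (∏ i : Fin m, MvPolynomial.X i ^ (l 0 * l i.succ)) *
        ∏ i : Fin m, ∏ j ∈ Ioi i,
          (MvPolynomial.X i - MvPolynomial.X j) ^ (l i.succ * l j.succ) := by
  have hC := det_deleteColumn_mul_of_mulVec_eq_zero _ _ (matU_mulVec_eq_zero l) h
  have h0 := minorU_zero l
  rw [minorU] at h0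
  rw [h0, Fin.val_zero, Nat.sub_zero, sigma_bigL0] at hC
  have hs : ((-1 : Coeffs m) ^ bigL l) * (-1) ^ bigL l = 1 := by
    rw [← mul_pow]; simp
  have hne : ((bigL0 l).factorial : Coeffs m) * (-1) ^ bigL l ≠ 0 :=
    mul_ne_zero (by exact_mod_cast Nat.factorial_ne_zero _) (pow_ne_zero _ (by norm_num))
  refine mul_left_cancel₀ hne ?_
  rw [minorU, hC]
  linear_combination (-((bigL0 l).factorial : Coeffs m) * (-1) ^ (h : ℕ) *
    ((bigL0 l - h).factorial : Coeffs m) * sigma l (bigL0 l - h) *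
    MvPolynomial.C (constF (Fin.snoc l 1 : Fin (m + 1 + 1) → ℕ)) *
    (∏ i : Fin m, MvPolynomial.X i ^ (l 0 * l i.succ)) *
    ∏ i : Fin m, ∏ j ∈ Ioi i,
      (MvPolynomial.X i - MvPolynomial.X j) ^ (l i.succ * l j.succ)) * hs

theorem minorU_ne_zero (l : Fin (m + 1) → ℕ) (h : Fin (bigL l + 1)) : minorU l h ≠ 0 := by
  rw [minorU_eq]
  have hF : (MvPolynomial.C (constF (Fin.snoc l 1 : Fin (m + 1 + 1) → ℕ)) : Coeffs m) ≠ 0 :=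
    MvPolynomial.C_ne_zero.2 (constF_ne_zero _)
  have h1 : ∀ n : ℕ, (-1 : Coeffs m) ^ n ≠ 0 := fun n => pow_ne_zero _ (by norm_num)
  refine mul_ne_zero (mul_ne_zero (mul_ne_zero (mul_ne_zero (mul_ne_zero (h1 _) ?_) ?_)
    (mul_ne_zero (h1 _) hF)) ?_) ?_
  · exact_mod_cast Nat.factorial_ne_zero _
  · exact sigma_ne_zero l (Nat.lt_succ_iff.1 h.2)
  · exact prod_ne_zero_iff.2 fun i _ => pow_ne_zero _ (MvPolynomial.X_ne_zero i)
  · refine prod_ne_zero_iff.2 fun i _ => prod_ne_zero_iff.2 fun j hj => pow_ne_zero _ ?_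
    exact sub_ne_zero.2 fun hij => (mem_Ioi.1 hj).ne (MvPolynomial.X_injective hij)

theorem rank_matU (l : Fin (m + 1) → ℕ) : (matU l).rank = bigL l := by
  refine le_antisymm ?_ ?_
  · simpa using (matU l).rank_le_card_height
  · have h := Matrix.rank_submatrix_le (matU l) id (Fin.succAbove 0)
    rwa [Matrix.rank_of_det_ne_zero (minorU_ne_zero l 0), Fintype.card_fin] at h

end HermitePade

theorem theorem5p1 (m : ℕ) (l : Fin (m + 1) → ℕ) (hl : ∀ i, 0 < l i) :
    -- the type II approximants, with the explicit denominator
    (∃ (A : Fin (m + 1) → Polynomial (HermitePade.Coeffs m))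
        (R : Fin m → PowerSeries (HermitePade.Coeffs m)),
      (∀ j : Fin m,
        (A 0 : PowerSeries (HermitePade.Coeffs m)) * HermitePade.expSeries j
          - (A j.succ : PowerSeries (HermitePade.Coeffs m)) = R j) ∧
      (∀ j : Fin (m + 1), (A j).natDegree ≤ HermitePade.bigL0 l - l j) ∧
      (∀ j : Fin m,
        ((HermitePade.bigL0 l + 1 : ℕ) : ℕ∞) ≤ (R j).order ∧ (R j).order < ⊤) ∧
      A 0 = ∑ h ∈ Finset.range (HermitePade.bigL l + 1),
        Polynomial.C (((HermitePade.bigL0 l - h).factorial : HermitePade.Coeffs m) *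
          HermitePade.sigma l (HermitePade.bigL0 l - h)) * Polynomial.X ^ h) ∧
    -- the complete factorisation of the minors, with `F = F_{m+1}(l₀, …, l_m, 1)`
    HermitePade.constF (Fin.snoc l 1 : Fin (m + 1 + 1) → ℕ) ≠ 0 ∧
    (∀ h : Fin (HermitePade.bigL l + 1),
      HermitePade.minorU l h =
        (-1) ^ (h : ℕ) * ((HermitePade.bigL0 l - h).factorial : HermitePade.Coeffs m) *
          HermitePade.sigma l (HermitePade.bigL0 l - h) *
          ((-1) ^ HermitePade.bigL l *
            MvPolynomial.C (HermitePade.constF (Fin.snoc l 1 : Fin (m + 1 + 1) → ℕ))) *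
          (∏ i : Fin m, MvPolynomial.X i ^ (l 0 * l i.succ)) *
          ∏ i : Fin m, ∏ j ∈ Finset.Ioi i,
            (MvPolynomial.X i - MvPolynomial.X j) ^ (l i.succ * l j.succ)) ∧
    (∀ h : Fin (HermitePade.bigL l + 1), HermitePade.minorU l h ≠ 0) ∧
    -- the rank over `ℚ[α₁, …, α_m]`
    (HermitePade.matU l).rank = HermitePade.bigL l :=
  ⟨HermitePade.exists_approximants l, HermitePade.constF_ne_zero _, HermitePade.minorU_eq l,
    HermitePade.minorU_ne_zero l, HermitePade.rank_matU l⟩
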